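/- Let $\{X, CX, CCX, F\}$ be the gate set in which $X=\begin{bmatrix}0&1\\1&0\end{bmatrix}$, $CX=I_2\oplus X$, $CCX=I_6\oplus X$ and $$F=\frac12\begin{bmatrix}1+i\sqrt2&1\\1&-1+i\sqrt2\end{bmatrix}.$$ A circuit on $k$ qubits over this set is a finite sequence of gates of the set, each applied to some distinct qubits among the $k$ (in any order), and it acts on $(\mathbb{C}^2)^{\otimes k}$ by the product of these operators. For $n,m\ge 0$, a $2^n\times 2^n$ complex matrix $V$ is exactly represented using $m$ (clean) ancillas if there is a circuit $D$ on $n+m$ qubits such that $D|\psi\rangle|0\rangle^{\otimes m}=(V|\psi\rangle)|0\rangle^{\otimes m}$ for every $n$-qubit state $|\psi\rangle$; it can be exactly represented by an $n$-qubit circuit if this holds for some $m\ge 0$. Let $$\mathbb{Z}[1/i\sqrt2]=\{x_0+x_1 i\sqrt2 \mid x_0,x_1\in\mathbb{Z}[1/2]\},$$ and let $U_{2^n}(\mathbb{Z}[1/i\sqrt2])$ be the group of $2^n\times2^n$ unitary matrices with entries in this ring. Then, for every $n\ge 0$, a $2^n\times 2^n$ complex matrix $V$ can be exactly represented by an $n$-qubit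 circuit over $\{X,CX,CCX,F\}$ if and only if $V\in U_{2^n}(\mathbb{Z}[1/i\sqrt2])$. Moreover, in that case $V$ can be exactly represented using a single ancilla. -/

import Mathlib

namespace QCircuit

/-- Labels of the computational basis of `n` qubits: bit strings of length `n`. There are `2 ^ n` of
them, and a `2 ^ n × 2 ^ n` matrix is a matrix with rows and columns indexed by them (the first bit
is the most significant one in the usual ordering of the basis). -/
abbrev Bits (n : ℕ) : Type := Fin n → Fin 2

/-! ### Rings and unitary groups -/

/-- The complex number `i√2`. -/
noncomputable def iSqrtTwo : ℂ := Complex.I * (Real.sqrt 2 : ℂ)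

/-- The dyadic fractions `u / 2 ^ q`, with `u` an integer and `q` a natural number. -/
def dyadic : Set ℂ := {z | ∃ (u : ℤ) (q : ℕ), z = (u : ℂ) / 2 ^ q}

/-- The ring `ℤ[1 / i√2]`, which consists of the numbers `x₀ + x₁ i√2` with `x₀`, `x₁` dyadic
fractions. -/
def dyadicISqrtTwo : Set ℂ := {z | ∃ x₀ ∈ dyadic, ∃ x₁ ∈ dyadic, z = x₀ + x₁ * iSqrtTwo}

/-- `U_{2 ^ n}(R)`: the `2 ^ n × 2 ^ n` unitary matrices with all entries in `R`. -/
def unitariesOver (n : ℕ) (R : Set ℂ) : Set (Matrix (Bits n) (Bits n) ℂ) :=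
  {V | V ∈ Matrix.unitaryGroup (Bits n) ℂ ∧ ∀ x y, V x y ∈ R}

/-! ### Gates -/

/-- A `2 × 2` matrix as an operator on one qubit. -/
def oneQubit (U : Matrix (Fin 2) (Fin 2) ℂ) : Matrix (Bits 1) (Bits 1) ℂ :=
  fun x y => U (x 0) (y 0)

/-- The controlled operator `I ⊕ U`; the first qubit is the control. -/
def controlled {k : ℕ} (U : Matrix (Bits k) (Bits k) ℂ) :
    Matrix (Bits (k + 1)) (Bits (k + 1)) ℂ :=
  fun x y =>
    if x 0 = y 0 then
      (if x 0 = 1 then U (Fin.tail x) (Fin.tail y)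
        else (1 : Matrix (Bits k) (Bits k) ℂ) (Fin.tail x) (Fin.tail y))
    else 0

/-- The NOT matrix. -/
def matX : Matrix (Fin 2) (Fin 2) ℂ := !![0, 1; 1, 0]

/-- The matrix `F = (1/2) [[1 + i√2, 1], [1, -1 + i√2]]`. -/
noncomputable def matF : Matrix (Fin 2) (Fin 2) ℂ :=
  (1 / 2 : ℂ) • !![1 + iSqrtTwo, 1; 1, -1 + iSqrtTwo]

/-- The gate set `{X, CX, CCX, F}`. -/
inductive Gate : Type
  | X
  | CX
  | CCX
  | F

/-- Number of qubits a gate acts on. -/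
def Gate.arity : Gate → ℕ
  | .X => 1
  | .CX => 2
  | .CCX => 3
  | .F => 1

/-- The matrix of a gate. -/
noncomputable def Gate.matrix : (g : Gate) → Matrix (Bits g.arity) (Bits g.arity) ℂ
  | .X => oneQubit matX
  | .CX => controlled (oneQubit matX)
  | .CCX => controlled (controlled (oneQubit matX))
  | .F => oneQubit matF

/-! ### Circuits -/

/-- The operator on `n` qubits that applies `U` to the `k` distinct qubits `w 0, …, w (k - 1)` and
the identity to all the others (that is, `U ⊗ I` up to reordering the tensor factors). -/
def onWires {k n : ℕ} (U : Matrix (Bits k) (Bits k) ℂ) (w : Fin k ↪ Fin n) :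
    Matrix (Bits n) (Bits n) ℂ :=
  fun x y => if ∀ j, (∀ i, w i ≠ j) → x j = y j then U (fun i => x (w i)) (fun i => y (w i)) else 0

/-- A gate of the gate set together with the distinct qubits, among `n`, that it is applied to. -/
structure PlacedGate (n : ℕ) where
  gate : Gate
  wires : Fin gate.arity ↪ Fin n

/-- An `n`-qubit circuit over `{X, CX, CCX, F}`: the list of its gates in order of application. -/
abbrev Circuit (n : ℕ) : Type := List (PlacedGate n)

/-- The operator of a circuit: the product of its gates, the first gate acting first. -/
noncomputable def Circuit.matrix {n : ℕ} : Circuit n → Matrix (Bits n) (Bits n) ℂ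
  | [] => 1
  | g :: C => Circuit.matrix C * onWires g.gate.matrix g.wires

/-! ### Exact representation with clean ancillas -/

/-- An `n`-qubit (pure) state: a unit vector. -/
def IsState {n : ℕ} (ψ : Bits n → ℂ) : Prop := ∑ x, ‖ψ x‖ ^ 2 = 1

/-- The basis state `|0⟩^{⊗ m}`. -/
def ketZero (m : ℕ) : Bits m → ℂ := fun x => if x = 0 then 1 else 0

/-- The tensor product `|ψ⟩|φ⟩`. -/
def tensor {n m : ℕ} (ψ : Bits n → ℂ) (φ : Bits m → ℂ) : Bits (n + m) → ℂ :=
  fun x => ψ (fun i => x (Fin.castAdd m i)) * φ (fun j => x (Fin.natAdd n j))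

/-- `V` is exactly represented by a circuit using `m` clean ancillas: some circuit `D` on `n + m`
qubits satisfies `D |ψ⟩|0⟩^{⊗ m} = (V |ψ⟩)|0⟩^{⊗ m}` for every `n`-qubit state `|ψ⟩`. -/
def RepresentableWithAncillas {n : ℕ} (m : ℕ) (V : Matrix (Bits n) (Bits n) ℂ) : Prop :=
  ∃ D : Circuit (n + m), ∀ ψ : Bits n → ℂ, IsState ψ →
    D.matrix.mulVec (tensor ψ (ketZero m)) = tensor (V.mulVec ψ) (ketZero m)

/-- `V` is exactly representable by an `n`-qubit circuit, ancillas being allowed. -/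
def ExactlyRepresentable {n : ℕ} (V : Matrix (Bits n) (Bits n) ℂ) : Prop :=
  ∃ m : ℕ, RepresentableWithAncillas m V

end QCircuit

/-! Necessity: every gate is unitary over the ring, hence so is every circuit operator `D`. Clean
ancillas make `V` the block of `D` on inputs and outputs with zero ancillas. `D` sends this subspace
into itself, so the block inherits orthonormal columns.

Sufficiency is proved with a borrowed ancilla, whose arbitrary state is left untouched; this is
stronger than a clean one. The operators `U` for which `U ⊗ I` is a circuit on one more qubit form a
monoid `borrowedMonoid`, closed under adjoints. It contains all basis permutations
(`perm_mem_borrowedMonoid`), because the extra qubit lets `CCX` build NOT gates with any number of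
controls. Identities between words in `F`, `X` and `Z` then turn `F` on one qubit into `F` on any
two basis states (`twoLevel_matF_mem_borrowedMonoid`), and likewise give a sign on any one basis
state (`negAt_mem_borrowedMonoid`).

These operators generate all unitaries over the ring (`dyadicUnitary_le`). Write `s = i√2`, so `s² =
-2`, and give a column the common denominator `s ^ k`, with numerators `a x + b x * s`. Being a unit
vector means `∑ (a x ^ 2 + 2 * b x ^ 2) = 2 ^ k`. A numerator is divisible by `s` exactly when its
`a x` is even; for `k > 0` the odd ones come in even number, and a suitable word in `F` and signs
makes two of them even at once (`exists_reduces`). Hence `k` can be lowered to `0`, where the column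
is a signed basis vector. Treating the columns one after another reduces the matrix to the identity.
-/

namespace QCircuit

/-! ### The ring `ℤ[1 / i√2]` -/

theorem iSqrtTwo_mul_self : iSqrtTwo * iSqrtTwo = -2 := by
  have h : ((Real.sqrt 2 : ℝ) : ℂ) * (Real.sqrt 2 : ℝ) = 2 := by
    rw [← Complex.ofReal_mul, Real.mul_self_sqrt (by norm_num)]; norm_num
  have hI := Complex.I_mul_I
  unfold iSqrtTwo
  linear_combination h * Complex.I * Complex.I + 2 * hI

theorem star_iSqrtTwo : star iSqrtTwo = -iSqrtTwo := by
  simp [iSqrtTwo]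

theorem iSqrtTwo_ne_zero : iSqrtTwo ≠ 0 := by
  intro h
  have := iSqrtTwo_mul_self
  simp [h] at this

theorem normSq_iSqrtTwo : Complex.normSq iSqrtTwo = 2 := by
  simp [iSqrtTwo]

theorem normSq_add_mul_iSqrtTwo (a b : ℤ) :
    Complex.normSq ((a : ℂ) + b * iSqrtTwo) = a ^ 2 + 2 * b ^ 2 := by
  have h : (Real.sqrt 2) * (Real.sqrt 2) = 2 := Real.mul_self_sqrt (by norm_num)
  simp [iSqrtTwo, Complex.normSq_apply]
  linear_combination (b : ℝ) ^ 2 * h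

theorem dyadic_intCast (u : ℤ) : (u : ℂ) ∈ dyadic := ⟨u, 0, by simp⟩

theorem dyadic_add {x y : ℂ} (hx : x ∈ dyadic) (hy : y ∈ dyadic) : x + y ∈ dyadic := by
  obtain ⟨u, q, rfl⟩ := hx
  obtain ⟨v, r, rfl⟩ := hy
  refine ⟨u * 2 ^ r + v * 2 ^ q, q + r, ?_⟩
  push_cast
  field_simp
  ring

theorem dyadic_mul {x y : ℂ} (hx : x ∈ dyadic) (hy : y ∈ dyadic) : x * y ∈ dyadic := by
  obtain ⟨u, q, rfl⟩ := hx
  obtain ⟨v, r, rfl⟩ := hy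
  refine ⟨u * v, q + r, ?_⟩
  push_cast
  field_simp
  ring

/-- `ℤ[1 / i√2]` as a subring of `ℂ`. -/
def dyadicSubring : Subring ℂ where
  carrier := dyadicISqrtTwo
  zero_mem' := ⟨0, by simpa using dyadic_intCast 0, 0, by simpa using dyadic_intCast 0, by simp⟩
  one_mem' := ⟨1, by simpa using dyadic_intCast 1, 0, by simpa using dyadic_intCast 0, by simp⟩
  add_mem' := by
    rintro _ _ ⟨x, hx, y, hy, rfl⟩ ⟨x', hx', y', hy', rfl⟩
    exact ⟨_, dyadic_add hx hx', _, dyadic_add hy hy', by ring⟩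
  neg_mem' := by
    rintro _ ⟨x, hx, y, hy, rfl⟩
    have h : ((-1 : ℤ) : ℂ) ∈ dyadic := dyadic_intCast _
    exact ⟨_, dyadic_mul h hx, _, dyadic_mul h hy, by push_cast; ring⟩
  mul_mem' := by
    rintro _ _ ⟨x, hx, y, hy, rfl⟩ ⟨x', hx', y', hy', rfl⟩
    have h : ((-2 : ℤ) : ℂ) ∈ dyadic := dyadic_intCast _
    refine ⟨_, dyadic_add (dyadic_mul hx hx') (dyadic_mul h (dyadic_mul hy hy')), _,
      dyadic_add (dyadic_mul hx hy') (dyadic_mul hy hx'), ?_⟩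
    push_cast
    linear_combination y * y' * iSqrtTwo_mul_self

theorem iSqrtTwo_mem : iSqrtTwo ∈ dyadicSubring :=
  ⟨0, by simpa using dyadic_intCast 0, 1, by simpa using dyadic_intCast 1, by simp⟩

theorem half_mem : (1 / 2 : ℂ) ∈ dyadicSubring :=
  ⟨1 / 2, ⟨1, 1, by simp⟩, 0, by simpa using dyadic_intCast 0, by simp⟩

/-- Elements of `ℤ[1 / i√2]` have a numerator in `ℤ[i√2]` over a power of `i√2`. -/
theorem exists_numerator {z : ℂ} (hz : z ∈ dyadicISqrtTwo) :
    ∃ (k : ℕ) (a b : ℤ), iSqrtTwo ^ k * z = a + b * iSqrtTwo := by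
  obtain ⟨_, ⟨u, q, rfl⟩, _, ⟨v, r, rfl⟩, rfl⟩ := hz
  -- An even power `2 * m` of `i√2` equals `(-2) ^ m`, which clears both dyadic denominators.
  refine ⟨2 * (q + r), (-1) ^ (q + r) * u * 2 ^ r, (-1) ^ (q + r) * v * 2 ^ q, ?_⟩
  rw [pow_mul, pow_two, iSqrtTwo_mul_self, neg_pow, pow_add 2]
  push_cast
  field_simp

theorem numerator_mono {z : ℂ} {k l : ℕ} (hkl : k ≤ l)
    (h : ∃ a b : ℤ, iSqrtTwo ^ k * z = a + b * iSqrtTwo) :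
    ∃ a b : ℤ, iSqrtTwo ^ l * z = a + b * iSqrtTwo := by
  induction l, hkl using Nat.le_induction with
  | base => exact h
  | succ l _ ih =>
    obtain ⟨a, b, hab⟩ := ih
    -- Multiplication by `s = i√2` turns `a + b s` into `-2 b + a s`.
    refine ⟨-2 * b, a, ?_⟩
    push_cast
    linear_combination iSqrtTwo * hab + b * iSqrtTwo_mul_self

/-! ### Unitary groups over a ring -/

/-- The unitary matrices with entries in `ℤ[1 / i√2]`, as a submonoid. -/
def dyadicUnitary (ι : Type*) [Fintype ι] [DecidableEq ι] : Submonoid (Matrix ι ι ℂ) where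
  carrier := {V | V ∈ Matrix.unitaryGroup ι ℂ ∧ ∀ x y, V x y ∈ dyadicSubring}
  one_mem' := ⟨one_mem _, fun x y => by
    rw [Matrix.one_apply]; split_ifs
    exacts [one_mem _, zero_mem _]⟩
  mul_mem' := fun hV hW => ⟨mul_mem hV.1 hW.1, fun x y => by
    rw [Matrix.mul_apply]
    exact sum_mem fun z _ => mul_mem (hV.2 x z) (hW.2 z y)⟩

/-! ### The matrix of a map between basis states -/

section FunMat

variable {ι : Type*} [Fintype ι] [DecidableEq ι]

/-- The matrix of the linear map sending the basis vector `y` to the basis vector `f y`. -/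
def funMat (f : ι → ι) : Matrix ι ι ℂ := fun x y => if x = f y then 1 else 0

theorem funMat_mul (f g : ι → ι) : funMat f * funMat g = funMat (f ∘ g) := by
  ext x y
  simp [Matrix.mul_apply, funMat]

omit [Fintype ι] in
theorem funMat_id : funMat (id : ι → ι) = 1 := by
  ext x y
  simp [funMat, Matrix.one_apply]

omit [Fintype ι] in
theorem funMat_star (σ : Equiv.Perm ι) : star (funMat σ) = funMat (σ⁻¹ : Equiv.Perm ι) := by
  ext x y
  simp only [Matrix.star_apply, funMat, Equiv.Perm.eq_inv_iff_eq, eq_comm (a := y)]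
  split_ifs <;> simp

theorem funMat_mem_dyadicUnitary (σ : Equiv.Perm ι) : funMat σ ∈ dyadicUnitary ι := by
  refine ⟨?_, fun x y => ?_⟩
  · rw [Matrix.mem_unitaryGroup_iff, funMat_star, funMat_mul, ← Equiv.Perm.coe_mul]
    simp [← funMat_id]
  · unfold funMat; split_ifs
    exacts [one_mem _, zero_mem _]

theorem funMat_mul_apply (σ : Equiv.Perm ι) (V : Matrix ι ι ℂ) (x y : ι) :
    (funMat σ * V) x y = V (σ⁻¹ x) y := by
  simp [Matrix.mul_apply, funMat, ← Equiv.Perm.inv_eq_iff_eq]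

end FunMat

/-! ### Operators on some of the qubits -/

section OnWires

variable {k l n : ℕ}

theorem onWires_one (w : Fin k ↪ Fin n) : onWires (1 : Matrix (Bits k) (Bits k) ℂ) w = 1 := by
  ext x y
  simp only [onWires, Matrix.one_apply]
  have : x = y ↔ (∀ j, (∀ i, w i ≠ j) → x j = y j) ∧
      (fun i => x (w i)) = (fun i => y (w i)) := by
    constructor
    · rintro rfl; simp
    · rintro ⟨h1, h2⟩
      funext j
      by_cases hj : ∃ i, w i = j
      · obtain ⟨i, rfl⟩ := hj
        exact congrFun h2 i
      · exact h1 j (by simpa using hj)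
  by_cases h1 : (∀ j, (∀ i, w i ≠ j) → x j = y j)
  · rw [if_pos h1]
    exact if_congr (by rw [this, and_iff_right h1]) rfl rfl
  · simp only [h1, if_false, this, false_and]

/-- Only the strings agreeing with `x` off the wires contribute to the row. `Function.extend w u x`
is `x` with the bits on the wires overwritten by `u`, so these strings are parametrised by `u`. -/
theorem onWires_sum_mul (w : Fin k ↪ Fin n) (U : Matrix (Bits k) (Bits k) ℂ) (x : Bits n)
    (f : Bits n → ℂ) :
    ∑ z, onWires U w x z * f z = ∑ u, U (fun i => x (w i)) u * f (Function.extend w u x) := by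
  symm
  refine Fintype.sum_of_injective (fun u => Function.extend w u x) ?_ _ _ ?_ ?_
  · intro u v huv
    funext i
    simpa [w.injective.extend_apply] using congrFun huv (w i)
  · intro z hz
    have : ¬ ∀ j, (∀ i, w i ≠ j) → x j = z j := by
      refine fun h => hz ⟨fun i => z (w i), ?_⟩
      funext j
      by_cases hj : ∃ i, w i = j
      · obtain ⟨i, rfl⟩ := hj
        exact w.injective.extend_apply _ _ i
      · simp only [Function.extend_apply' _ _ _ hj]
        exact h j (by simpa using hj)
    simp [onWires, this]
  · intro u
    have : ∀ j, (∀ i, w i ≠ j) → x j = Function.extend w u x j := by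
      intro j hj
      rw [Function.extend_apply' _ _ _ (by simpa using hj)]
    simp only [onWires, if_pos this, w.injective.extend_apply]

theorem onWires_mul (w : Fin k ↪ Fin n) (U V : Matrix (Bits k) (Bits k) ℂ) :
    onWires (U * V) w = onWires U w * onWires V w := by
  ext x y
  rw [Matrix.mul_apply, onWires_sum_mul]
  have h : ∀ u, (∀ j, (∀ i, w i ≠ j) → Function.extend w u x j = y j) ↔
      (∀ j, (∀ i, w i ≠ j) → x j = y j) := fun u =>
    forall₂_congr fun j hj => by rw [Function.extend_apply' _ _ _ (by simpa using hj)]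
  simp only [onWires, h, w.injective.extend_apply, Matrix.mul_apply]
  split_ifs <;> simp

/-- Applying an operator to given qubits, as a monoid homomorphism. -/
def onWiresHom (w : Fin k ↪ Fin n) :
    Matrix (Bits k) (Bits k) ℂ →* Matrix (Bits n) (Bits n) ℂ where
  toFun U := onWires U w
  map_one' := onWires_one w
  map_mul' := onWires_mul w

theorem onWiresHom_apply (w : Fin k ↪ Fin n) (U : Matrix (Bits k) (Bits k) ℂ) :
    onWiresHom w U = onWires U w := rfl

theorem onWires_star (w : Fin k ↪ Fin n) (U : Matrix (Bits k) (Bits k) ℂ) :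
    onWires (star U) w = star (onWires U w) := by
  ext x y
  simp only [onWires, Matrix.star_apply, eq_comm (a := y _)]
  split_ifs <;> simp

theorem onWires_mem_dyadicUnitary (w : Fin k ↪ Fin n) {U : Matrix (Bits k) (Bits k) ℂ}
    (hU : U ∈ dyadicUnitary (Bits k)) : onWires U w ∈ dyadicUnitary (Bits n) := by
  refine ⟨?_, fun x y => ?_⟩
  · rw [Matrix.mem_unitaryGroup_iff, ← onWires_star, ← onWires_mul,
      Matrix.mem_unitaryGroup_iff.1 hU.1, onWires_one]
  · unfold onWires; split_ifs
    exacts [hU.2 _ _, zero_mem _]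

theorem onWires_onWires (w : Fin k ↪ Fin l) (w' : Fin l ↪ Fin n)
    (U : Matrix (Bits k) (Bits k) ℂ) :
    onWires (onWires U w) w' = onWires U (w.trans w') := by
  ext x y
  have h : (∀ j, (∀ i, (w.trans w') i ≠ j) → x j = y j) ↔
      (∀ j, (∀ i, w' i ≠ j) → x j = y j) ∧
        (∀ j, (∀ i, w i ≠ j) → x (w' j) = y (w' j)) := by
    constructor
    · exact fun h => ⟨fun j hj => h j fun i => hj _, fun j hj => h _ fun i hi =>
        hj i (w'.injective hi)⟩
    · rintro ⟨h1, h2⟩ j hj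
      by_cases hj' : ∃ i, w' i = j
      · obtain ⟨i, rfl⟩ := hj'
        exact h2 i fun i' hi' => hj i' (by simp [hi'])
      · exact h1 j (by simpa using hj')
  simp only [onWires, h, ← ite_and]
  rfl

end OnWires

/-! ### Multiply controlled NOT gates -/

section CtrlNot

/-- Flip bit `t` if all the bits in `C` are `1`. -/
def ctrlNot {n : ℕ} (C : Finset (Fin n)) (t : Fin n) (x : Bits n) : Bits n :=
  if ∀ c ∈ C, x c = 1 then Function.update x t (x t + 1) else x

theorem fin_two_add_one_add_one (a : Fin 2) : a + 1 + 1 = a := by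
  fin_cases a <;> rfl

theorem ctrlNot_apply_of_ne {n : ℕ} {C : Finset (Fin n)} {t j : Fin n} (h : j ≠ t) (x : Bits n) :
    ctrlNot C t x j = x j := by
  unfold ctrlNot; split_ifs <;> simp [h]

theorem ctrlNot_apply_self {n : ℕ} {C : Finset (Fin n)} {t : Fin n} (x : Bits n) :
    ctrlNot C t x t = if ∀ c ∈ C, x c = 1 then x t + 1 else x t := by
  unfold ctrlNot; split_ifs <;> simp

theorem forall_ctrlNot_iff {n : ℕ} {C D : Finset (Fin n)} {t : Fin n} (h : t ∉ D) (x : Bits n) :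
    (∀ c ∈ D, ctrlNot C t x c = 1) ↔ ∀ c ∈ D, x c = 1 :=
  forall₂_congr fun c hc => by rw [ctrlNot_apply_of_ne (ne_of_mem_of_not_mem hc h)]

theorem ctrlNot_involutive {n : ℕ} {C : Finset (Fin n)} {t : Fin n} (h : t ∉ C) :
    Function.Involutive (ctrlNot C t) := by
  intro x
  funext j
  by_cases hj : j = t
  · subst hj
    simp only [ctrlNot_apply_self, forall_ctrlNot_iff h]
    split_ifs <;> simp [fin_two_add_one_add_one]
  · simp [ctrlNot_apply_of_ne hj]

/-- A NOT gate with one more control, from a borrowed qubit `d`. -/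
theorem ctrlNot_insert {n : ℕ} {C : Finset (Fin n)} {c t d : Fin n} (hct : c ≠ t)
    (hcd : c ≠ d) (htd : t ≠ d) (ht : t ∉ C) (hd : d ∉ C) :
    -- A commutator: `t` is flipped by `c ∧ d` and by `c ∧ (d ⊕ ⋀C)`, in total by `c ∧ ⋀C`, whereas
    -- `d` is flipped twice by `⋀C` and so restored.
    ctrlNot (insert c C) t =
      ctrlNot C d ∘ ctrlNot {c, d} t ∘ ctrlNot C d ∘ ctrlNot {c, d} t := by
  funext x j
  simp only [Function.comp_apply]
  by_cases hjd : j = d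
  · subst hjd
    simp only [ctrlNot_apply_self, forall_ctrlNot_iff ht, forall_ctrlNot_iff hd,
      ctrlNot_apply_of_ne htd.symm]
    split_ifs <;> simp [fin_two_add_one_add_one]
  by_cases hjt : j = t
  · subst hjt
    rw [ctrlNot_apply_of_ne hjd]
    simp only [ctrlNot_apply_self, Finset.forall_mem_insert, Finset.mem_singleton, forall_eq,
      ctrlNot_apply_of_ne hct, ctrlNot_apply_of_ne hcd, ctrlNot_apply_of_ne htd,
      ctrlNot_apply_of_ne htd.symm, forall_ctrlNot_iff ht]
    have hd' : x d = 0 ∨ x d = 1 := by omega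
    by_cases h2 : ∀ c ∈ C, x c = 1
    · simp only [if_pos h2]
      by_cases h1 : x c = 1 <;> rcases hd' with h3 | h3 <;>
        simp [h1, h3, if_pos h2]
    · simp only [if_neg h2]
      by_cases h1 : x c = 1 <;> rcases hd' with h3 | h3 <;>
        simp [h1, h3, fin_two_add_one_add_one, if_neg h2]
  · simp [ctrlNot_apply_of_ne hjt, ctrlNot_apply_of_ne hjd]

theorem onWires_ctrlNot {k n : ℕ} (w : Fin k ↪ Fin n) (C : Finset (Fin k)) (t : Fin k) :
    onWires (funMat (ctrlNot C t)) w = funMat (ctrlNot (C.map w) (w t)) := by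
  ext x y
  have h : x = ctrlNot (C.map w) (w t) y ↔ (∀ j, (∀ i, w i ≠ j) → x j = y j) ∧
      (fun i => x (w i)) = ctrlNot C t (fun i => y (w i)) := by
    have key : ∀ i, ctrlNot (C.map w) (w t) y (w i) = ctrlNot C t (fun i => y (w i)) i := by
      intro i
      by_cases hi : i = t
      · subst hi
        simp [ctrlNot_apply_self]
      · rw [ctrlNot_apply_of_ne hi, ctrlNot_apply_of_ne (fun e => hi (w.injective e))]
    constructor
    · rintro rfl
      exact ⟨fun j hj => ctrlNot_apply_of_ne (hj t).symm y, funext key⟩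
    · rintro ⟨h1, h2⟩
      funext j
      by_cases hj : ∃ i, w i = j
      · obtain ⟨i, rfl⟩ := hj
        rw [key, ← h2]
      · have hj : ∀ i, w i ≠ j := by simpa using hj
        rw [h1 j hj, ctrlNot_apply_of_ne (hj t).symm]
  simp only [onWires, funMat, h, ite_and]

theorem oneQubit_matX : oneQubit matX = funMat (ctrlNot ∅ 0) := by
  ext x y
  have h : x = ctrlNot ∅ 0 y ↔ x 0 = y 0 + 1 := by
    rw [funext_iff, Fin.forall_fin_one]
    simp [ctrlNot_apply_self]
  simp only [oneQubit, funMat, h]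
  generalize x 0 = a
  generalize y 0 = b
  fin_cases a <;> fin_cases b <;> simp [matX]

theorem controlled_ctrlNot {k : ℕ} (C : Finset (Fin k)) (t : Fin k) :
    controlled (funMat (ctrlNot C t)) =
      funMat (ctrlNot (insert 0 (C.map (Fin.succEmb k))) t.succ) := by
  ext x y
  have h : x = ctrlNot (insert 0 (C.map (Fin.succEmb k))) t.succ y ↔
      x 0 = y 0 ∧ Fin.tail x = if y 0 = 1 then ctrlNot C t (Fin.tail y) else Fin.tail y := by
    rw [funext_iff, Fin.forall_fin_succ]
    refine and_congr ?_ ?_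
    · rw [ctrlNot_apply_of_ne (Fin.succ_ne_zero t).symm]
    · rw [funext_iff]
      refine forall_congr' fun i => ?_
      by_cases hi : i = t
      · subst hi
        by_cases h0 : y 0 = 1
        · simp only [h0, ctrlNot_apply_self, Fin.tail, if_true, Finset.forall_mem_insert, true_and,
            Finset.forall_mem_map, Fin.coe_succEmb]
          congr!
        · simp [h0, ctrlNot_apply_self, Fin.tail]
      · rw [ctrlNot_apply_of_ne (by simpa using hi)]
        split_ifs
        · simp [ctrlNot_apply_of_ne hi, Fin.tail]
        · simp [Fin.tail]
  simp only [controlled, funMat, h, ite_and, Matrix.one_apply]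
  by_cases h0 : x 0 = y 0
  · simp only [h0, if_true]
    split_ifs <;> simp_all
  · simp [h0]

end CtrlNot

/-! ### The gates -/

theorem Gate.matrix_X : Gate.X.matrix = funMat (ctrlNot ∅ (0 : Fin 1)) := oneQubit_matX

theorem Gate.matrix_CX : Gate.CX.matrix = funMat (ctrlNot {0} (1 : Fin 2)) := by
  change controlled (oneQubit matX) = _
  rw [oneQubit_matX, controlled_ctrlNot]
  rfl

theorem Gate.matrix_CCX : Gate.CCX.matrix = funMat (ctrlNot {0, 1} (2 : Fin 3)) := by
  change controlled (controlled (oneQubit matX)) = _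
  rw [oneQubit_matX, controlled_ctrlNot, controlled_ctrlNot]
  rfl

theorem oneQubit_mul (U V : Matrix (Fin 2) (Fin 2) ℂ) :
    oneQubit (U * V) = oneQubit U * oneQubit V := by
  ext x y
  simp only [oneQubit, Matrix.mul_apply]
  exact (Fintype.sum_equiv (Equiv.funUnique (Fin 1) (Fin 2)) _ _ fun z => rfl).symm

theorem oneQubit_one : oneQubit 1 = 1 := by
  ext x y
  simp [oneQubit, Matrix.one_apply, funext_iff]

/-- One-qubit operators, as a monoid homomorphism. -/
def oneQubitHom : Matrix (Fin 2) (Fin 2) ℂ →* Matrix (Bits 1) (Bits 1) ℂ where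
  toFun := oneQubit
  map_one' := oneQubit_one
  map_mul' := oneQubit_mul

theorem oneQubit_star (U : Matrix (Fin 2) (Fin 2) ℂ) : oneQubit (star U) = star (oneQubit U) := rfl

/-- The Pauli matrix `Z`. -/
def matZ : Matrix (Fin 2) (Fin 2) ℂ := !![1, 0; 0, -1]

/-- `F²` is `i` times the Hadamard matrix, which is why conjugation by it exchanges `X` and `Z`. -/
theorem matF_mul_matF : matF * matF = (iSqrtTwo / 2) • !![1, 1; 1, -1] := by
  have h := iSqrtTwo_mul_self
  ext i j
  fin_cases i <;> fin_cases j <;> simp [matF, Matrix.mul_apply, Fin.sum_univ_two] <;>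
    first | ring1 | linear_combination (1 / 4) * h

theorem matF_pow_four : matF ^ 4 = -1 := by
  have h := iSqrtTwo_mul_self
  rw [show 4 = 2 * 2 from rfl, pow_mul, pow_two, pow_two, matF_mul_matF]
  ext i j
  fin_cases i <;> fin_cases j <;> simp [Matrix.mul_apply, Fin.sum_univ_two] <;>
    first | ring1 | linear_combination (1 / 2) * h

theorem matF_pow_eight : matF ^ 8 = 1 := by
  rw [show 8 = 4 * 2 from rfl, pow_mul, matF_pow_four]
  simp

theorem star_matF_mul : star matF * matF = 1 := by
  have h := iSqrtTwo_mul_self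
  have h2 : (starRingEnd ℂ) iSqrtTwo = -iSqrtTwo := star_iSqrtTwo
  ext i j
  fin_cases i <;> fin_cases j <;>
    simp [matF, Matrix.mul_apply, Fin.sum_univ_two, Matrix.star_apply, h2, map_ofNat] <;>
    first | ring1 | linear_combination (1 / 4) * h | linear_combination (-1 / 4) * h

theorem star_matF : star matF = matF ^ 7 := by
  rw [← one_mul (matF ^ 7), ← star_matF_mul, mul_assoc, ← pow_succ', matF_pow_eight, mul_one]

theorem matF_conj_matX : matF ^ 2 * matX * matF ^ 6 = matZ := by
  have h := iSqrtTwo_mul_self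
  have h6 : matF ^ 6 = -(matF * matF) := by
    rw [show 6 = 4 + 2 from rfl, pow_add, matF_pow_four, pow_two, neg_one_mul]
  rw [h6, pow_two, matF_mul_matF]
  ext i j
  fin_cases i <;> fin_cases j <;> simp [matX, matZ, Matrix.mul_apply, Fin.sum_univ_two] <;>
    first | ring1 | linear_combination (1 / 2) * h | linear_combination (-1 / 2) * h

/-- To be paired with `matF_word_eq_one`: both words contain `F` in the same two places and differ
only in Paulis, which can be chosen separately for each state of the other qubits. One word gives
`F`, the other the identity. -/
theorem matF_eq_word : matZ * matF * matX * matF * matZ = matF := by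
  have h := iSqrtTwo_mul_self
  ext i j
  fin_cases i <;> fin_cases j <;>
    simp [matX, matZ, matF, Matrix.mul_apply, Fin.sum_univ_two]
  all_goals
    first | ring1 | linear_combination (1 / 4) * h | linear_combination (-1 / 4) * h

/-- Up to a scalar `X Z` is the Pauli matrix `Y`, which anticommutes with the parts `X` and `Z` of
`F = (i√2 + X + Z) / 2`; sandwiching `F` between two copies of `X Z` therefore inverts it. -/
theorem matF_word_eq_one : matF * (matX * matZ) * matF * (matX * matZ) = 1 := by
  have h := iSqrtTwo_mul_self
  ext i j
  fin_cases i <;> fin_cases j <;>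
    simp [matX, matZ, matF, Matrix.mul_apply, Fin.sum_univ_two]
  all_goals
    first | ring1 | linear_combination (1 / 4) * h | linear_combination (-1 / 4) * h

theorem matF_apply_mem (i j : Fin 2) : matF i j ∈ dyadicSubring := by
  have h : ∀ z ∈ dyadicSubring, (1 / 2 : ℂ) * z ∈ dyadicSubring := fun z hz => mul_mem half_mem hz
  have h1 := one_mem dyadicSubring
  have hs := iSqrtTwo_mem
  fin_cases i <;> fin_cases j
  exacts [h _ (add_mem h1 hs), h _ h1, h _ h1, h _ (add_mem (neg_mem h1) hs)]

theorem oneQubit_matF_mem : oneQubit matF ∈ dyadicUnitary (Bits 1) := by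
  refine ⟨?_, fun x y => matF_apply_mem _ _⟩
  rw [Matrix.mem_unitaryGroup_iff', ← oneQubit_star, ← oneQubit_mul, star_matF_mul, oneQubit_one]

theorem funMat_ctrlNot_mem_dyadicUnitary {n : ℕ} {C : Finset (Fin n)} {t : Fin n} (h : t ∉ C) :
    funMat (ctrlNot C t) ∈ dyadicUnitary (Bits n) :=
  funMat_mem_dyadicUnitary (ctrlNot_involutive h).toPerm

theorem star_funMat_ctrlNot {n : ℕ} {C : Finset (Fin n)} {t : Fin n} (h : t ∉ C) :
    star (funMat (ctrlNot C t)) = funMat (ctrlNot C t) :=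
  funMat_star (ctrlNot_involutive h).toPerm

theorem Gate.matrix_mem_dyadicUnitary (g : Gate) : g.matrix ∈ dyadicUnitary (Bits g.arity) := by
  cases g
  · exact (Gate.matrix_X).symm ▸ funMat_ctrlNot_mem_dyadicUnitary (n := 1) (by decide)
  · exact (Gate.matrix_CX).symm ▸ funMat_ctrlNot_mem_dyadicUnitary (n := 2) (by decide)
  · exact (Gate.matrix_CCX).symm ▸ funMat_ctrlNot_mem_dyadicUnitary (n := 3) (by decide)
  · exact oneQubit_matF_mem

/-- This makes circuit operators closed under adjoints without adding inverse gates. -/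
theorem Gate.exists_star_matrix (g : Gate) : ∃ k, star g.matrix = g.matrix ^ k := by
  cases g
  · exact ⟨1, (congrArg star Gate.matrix_X).trans
      ((star_funMat_ctrlNot (n := 1) (by decide)).trans
        (Gate.matrix_X.symm.trans (pow_one _).symm))⟩
  · exact ⟨1, (congrArg star Gate.matrix_CX).trans
      ((star_funMat_ctrlNot (n := 2) (by decide)).trans
        (Gate.matrix_CX.symm.trans (pow_one _).symm))⟩
  · exact ⟨1, (congrArg star Gate.matrix_CCX).trans
      ((star_funMat_ctrlNot (n := 3) (by decide)).trans
        (Gate.matrix_CCX.symm.trans (pow_one _).symm))⟩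
  · exact ⟨7, (oneQubit_star matF).symm.trans
      ((congrArg oneQubit star_matF).trans (map_pow oneQubitHom matF 7))⟩

/-! ### The operators of circuits -/

theorem Circuit.matrix_append {n : ℕ} (C D : Circuit n) :
    Circuit.matrix (C ++ D) = D.matrix * C.matrix := by
  induction C with
  | nil => simp [Circuit.matrix]
  | cons g C ih => simp [Circuit.matrix, ih, mul_assoc]

/-- The operators of `n`-qubit circuits. -/
noncomputable def circuitMonoid (n : ℕ) : Submonoid (Matrix (Bits n) (Bits n) ℂ) where
  carrier := {M | ∃ D : Circuit n, D.matrix = M}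
  one_mem' := ⟨[], rfl⟩
  mul_mem' := by
    rintro _ _ ⟨C, rfl⟩ ⟨D, rfl⟩
    exact ⟨D ++ C, Circuit.matrix_append D C⟩

theorem gate_mem_circuitMonoid {n : ℕ} (g : Gate) (w : Fin g.arity ↪ Fin n) :
    onWires g.matrix w ∈ circuitMonoid n := ⟨[⟨g, w⟩], by simp [Circuit.matrix]⟩

theorem circuitMonoid_induction {n : ℕ} {S : Submonoid (Matrix (Bits n) (Bits n) ℂ)}
    (h : ∀ (g : Gate) (w : Fin g.arity ↪ Fin n), onWires g.matrix w ∈ S) : circuitMonoid n ≤ S := by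
  rintro _ ⟨D, rfl⟩
  induction D with
  | nil => exact one_mem S
  | cons g D ih => exact mul_mem ih (h _ _)

theorem circuitMonoid_le_dyadicUnitary (n : ℕ) : circuitMonoid n ≤ dyadicUnitary (Bits n) :=
  circuitMonoid_induction fun g w => onWires_mem_dyadicUnitary w g.matrix_mem_dyadicUnitary

theorem star_mem_circuitMonoid {n : ℕ} {M : Matrix (Bits n) (Bits n) ℂ}
    (hM : M ∈ circuitMonoid n) : star M ∈ circuitMonoid n := by
  obtain ⟨D, rfl⟩ := hM
  induction D with
  | nil => simp [Circuit.matrix]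
  | cons g D ih =>
    rw [Circuit.matrix, star_mul]
    refine mul_mem ?_ ih
    obtain ⟨k, hk⟩ := g.gate.exists_star_matrix
    rw [← onWires_star, hk, ← onWiresHom_apply, map_pow]
    exact pow_mem (gate_mem_circuitMonoid g.gate g.wires) k

/-! ### Representable matrices are unitary over `ℤ[1 / i√2]` -/

theorem onWires_castAdd_mulVec_tensor {n m : ℕ} (U : Matrix (Bits n) (Bits n) ℂ)
    (ψ : Bits n → ℂ) (φ : Bits m → ℂ) :
    (onWires U (Fin.castAddEmb m)).mulVec (tensor ψ φ) = tensor (U.mulVec ψ) φ := by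
  funext x
  have h1 : ∀ u : Bits n, (fun i => Function.extend (Fin.castAddEmb m) u x (Fin.castAdd m i)) = u :=
    fun u => funext fun i => (Fin.castAddEmb m).injective.extend_apply _ _ i
  have h2 : ∀ u : Bits n, (fun j => Function.extend (Fin.castAddEmb m) u x (Fin.natAdd n j)) =
      fun j => x (Fin.natAdd n j) := fun u => funext fun j => by
    rw [Function.extend_apply']
    rintro ⟨i, hi⟩
    have := congrArg Fin.val hi
    simp at this
    omega
  simp only [Matrix.mulVec, dotProduct]
  rw [onWires_sum_mul]
  simp only [tensor, h1, h2, Finset.sum_mul, Matrix.mulVec, dotProduct, mul_assoc]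
  rfl

theorem isState_single {n : ℕ} (y : Bits n) : IsState (Pi.single y (1 : ℂ)) := by
  unfold IsState
  rw [Finset.sum_eq_single y] <;> simp +contextual

theorem RepresentableWithAncillas.mem_dyadicUnitary {n m : ℕ} {V : Matrix (Bits n) (Bits n) ℂ}
    (h : RepresentableWithAncillas m V) : V ∈ dyadicUnitary (Bits n) := by
  obtain ⟨D, hD⟩ := h
  obtain ⟨hU, hR⟩ := circuitMonoid_le_dyadicUnitary _ ⟨D, rfl⟩
  -- `e` appends zero ancillas; `V` will be the block of the circuit matrix on its range.
  let e : Bits n → Bits (n + m) := fun y => Fin.append y 0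
  have he : ∀ y, tensor (Pi.single y (1 : ℂ)) (ketZero m) = Pi.single (e y) 1 := by
    intro y
    funext x
    have : x = e y ↔ (fun i => x (Fin.castAdd m i)) = y ∧ (fun j => x (Fin.natAdd n j)) = 0 := by
      constructor
      · rintro rfl
        constructor <;> funext i <;> simp [e]
      · rintro ⟨rfl, h⟩
        funext i
        refine Fin.addCases (fun i => ?_) (fun i => ?_) i
        · simp [e]
        · simpa [e] using congrFun h i
    simp only [tensor, Pi.single_apply, ketZero, this, ite_and]
    split_ifs <;> simp
  have hcol : ∀ x y, D.matrix x (e y) = tensor (V.mulVec (Pi.single y 1)) (ketZero m) x := by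
    intro x y
    rw [← hD _ (isState_single y), he]
    simp
  have hin : Function.Injective e := by
    intro y y' h
    funext i
    simpa [e] using congrFun h (Fin.castAdd m i)
  have hV : ∀ x y, D.matrix (e x) (e y) = V x y := by
    intro x y
    rw [hcol]
    simp [tensor, e, ketZero]
    intro h
    exact absurd (by funext i; simp) h
  have hV0 : ∀ x, x ∉ Set.range e → ∀ y, D.matrix x (e y) = 0 := by
    intro x hx y
    rw [hcol, tensor, ketZero, if_neg, mul_zero]
    intro h
    refine hx ⟨fun i => x (Fin.castAdd m i), ?_⟩
    funext i
    refine Fin.addCases (fun i => ?_) (fun i => ?_) i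
    · simp [e]
    · simpa [e] using (congrFun h i).symm
  refine ⟨?_, fun x y => hV x y ▸ hR _ _⟩
  rw [Matrix.mem_unitaryGroup_iff'] at hU ⊢
  ext x y
  have := congrFun (congrFun hU (e x)) (e y)
  rw [Matrix.mul_apply] at this ⊢
  have h1 : (1 : Matrix _ _ ℂ) (e x) (e y) = (1 : Matrix _ _ ℂ) x y := by
    simp only [Matrix.one_apply, hin.eq_iff]
  rw [← h1, ← this]
  -- The columns indexed by the range of `e` vanish outside that range, so their inner products
  -- involve only the block `V`.
  refine Fintype.sum_of_injective e hin _ _ (fun z hz => ?_) (fun z => ?_)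
  · rw [hV0 z hz, mul_zero]
  · simp only [Matrix.star_apply, hV]

/-! ### Operators realised with a borrowed ancilla -/

/-- The operators on `n` qubits that a circuit realises with one borrowed ancilla. -/
noncomputable def borrowedMonoid (n : ℕ) : Submonoid (Matrix (Bits n) (Bits n) ℂ) :=
  (circuitMonoid (n + 1)).comap (onWiresHom (Fin.castAddEmb 1))

theorem mem_borrowedMonoid {n : ℕ} {U : Matrix (Bits n) (Bits n) ℂ} :
    U ∈ borrowedMonoid n ↔ onWires U (Fin.castAddEmb 1) ∈ circuitMonoid (n + 1) := Iff.rfl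

theorem representable_of_mem_borrowedMonoid {n : ℕ} {U : Matrix (Bits n) (Bits n) ℂ}
    (h : U ∈ borrowedMonoid n) : RepresentableWithAncillas 1 U := by
  obtain ⟨D, hD⟩ := h
  exact ⟨D, fun ψ _ => by rw [hD]; exact onWires_castAdd_mulVec_tensor U ψ _⟩

theorem borrowedMonoid_le_dyadicUnitary (n : ℕ) : borrowedMonoid n ≤ dyadicUnitary (Bits n) :=
  fun _ h => (representable_of_mem_borrowedMonoid h).mem_dyadicUnitary

theorem star_mem_borrowedMonoid {n : ℕ} {U : Matrix (Bits n) (Bits n) ℂ}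
    (h : U ∈ borrowedMonoid n) : star U ∈ borrowedMonoid n := by
  rw [mem_borrowedMonoid, onWires_star]
  exact star_mem_circuitMonoid h

/-! ### Permutations of the basis states -/

theorem ctrlNot_mem_circuitMonoid {n : ℕ} (C : Finset (Fin n)) :
    ∀ t d, t ∉ C → d ∉ C → t ≠ d → funMat (ctrlNot C t) ∈ circuitMonoid n := by
  induction C using Finset.induction_on with
  | empty =>
    intro t d _ _ _
    have := gate_mem_circuitMonoid .X ⟨fun _ => t, fun _ _ _ => Subsingleton.elim (α := Fin 1) _ _⟩
    rw [Gate.matrix_X] at this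
    have h2 := onWires_ctrlNot (k := 1)
      ⟨fun _ => t, fun _ _ _ => Subsingleton.elim (α := Fin 1) _ _⟩ ∅ 0
    rw [Finset.map_empty] at h2
    exact h2 ▸ this
  | insert c C hc ih =>
    intro t d ht hd htd
    simp only [Finset.mem_insert, not_or] at ht hd
    have h1 : funMat (ctrlNot {c, d} t) ∈ circuitMonoid n := by
      have hw : Function.Injective (![c, d, t] : Fin 3 → Fin n) := by
        intro i j
        fin_cases i <;> fin_cases j <;> simp [ht.1, hd.1, htd, Ne.symm ht.1, Ne.symm hd.1, htd.symm]
      have := gate_mem_circuitMonoid .CCX ⟨![c, d, t], hw⟩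
      rw [Gate.matrix_CCX] at this
      have h2 := onWires_ctrlNot (k := 3) ⟨![c, d, t], hw⟩ {0, 1} 2
      rw [Finset.map_insert, Finset.map_singleton] at h2
      exact h2 ▸ this
    -- The roles are exchanged: for the smaller gate with target `d`, the qubit `t` is the borrowed
    -- one.
    have h2 := ih d t hd.2 ht.2 htd.symm
    rw [ctrlNot_insert (Ne.symm ht.1) (Ne.symm hd.1) htd ht.2 hd.2, ← funMat_mul, ← funMat_mul,
      ← funMat_mul]
    exact mul_mem h2 (mul_mem h1 (mul_mem h2 h1))

theorem ctrlNot_mem_borrowedMonoid {n : ℕ} {C : Finset (Fin n)} {t : Fin n} (h : t ∉ C) :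
    funMat (ctrlNot C t) ∈ borrowedMonoid n := by
  rw [mem_borrowedMonoid, onWires_ctrlNot]
  -- The ancilla is the borrowed qubit; it is distinct from the target and all controls.
  refine ctrlNot_mem_circuitMonoid _ _ (Fin.natAdd n 0) (by simpa using h) ?_ ?_
  · simp only [Finset.mem_map, not_exists, not_and]
    intro i _ hi
    have := congrArg Fin.val hi
    simp at this
    omega
  · intro hi
    have := congrArg Fin.val hi
    simp at this
    omega

/-- The permutations of basis states that a circuit realises with one borrowed ancilla. -/
noncomputable def borrowedPerm (n : ℕ) : Subgroup (Equiv.Perm (Bits n)) where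
  carrier := {σ | funMat σ ∈ borrowedMonoid n}
  one_mem' := by
    change funMat (id : Bits n → Bits n) ∈ borrowedMonoid n
    rw [funMat_id]; exact one_mem _
  mul_mem' := fun {σ τ} h1 h2 => by
    change funMat (σ * τ : Equiv.Perm (Bits n)) ∈ borrowedMonoid n
    rw [Equiv.Perm.coe_mul, ← funMat_mul]
    exact mul_mem h1 h2
  inv_mem' := fun {σ} h => by
    change funMat (σ⁻¹ : Equiv.Perm (Bits n)) ∈ borrowedMonoid n
    rw [← funMat_star]
    exact star_mem_borrowedMonoid h

theorem mem_borrowedPerm {n : ℕ} {σ : Equiv.Perm (Bits n)} :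
    σ ∈ borrowedPerm n ↔ funMat σ ∈ borrowedMonoid n := Iff.rfl

/-- Addition in `Bits n` is bitwise XOR, so translations are products of `X` gates. -/
theorem addRight_mem_borrowedPerm {n : ℕ} (a : Bits n) :
    Equiv.addRight a ∈ borrowedPerm n := by
  let S : AddSubmonoid (Bits n) :=
    { carrier := {a | Equiv.addRight a ∈ borrowedPerm n}
      zero_mem' := by
        change Equiv.addRight (0 : Bits n) ∈ borrowedPerm n
        rw [show Equiv.addRight (0 : Bits n) = 1 by ext; simp]
        exact one_mem _
      add_mem' := fun {a b} ha hb => by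
        change Equiv.addRight (a + b) ∈ borrowedPerm n
        rw [show Equiv.addRight (a + b) = Equiv.addRight b * Equiv.addRight a by
          ext; simp [add_assoc]]
        exact mul_mem hb ha }
  change a ∈ S
  have hsingle : ∀ i (x : Fin 2), Pi.single i x ∈ S := by
    intro i x
    rcases (by omega : x = 0 ∨ x = 1) with rfl | rfl
    · rw [Pi.single_zero]; exact zero_mem S
    · change funMat _ ∈ borrowedMonoid n
      convert ctrlNot_mem_borrowedMonoid (C := ∅) (t := i) (by simp) using 1
      congr 1
      funext y j
      by_cases hj : j = i
      · subst hj; simp [ctrlNot_apply_self]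
      · simp [ctrlNot_apply_of_ne hj, hj]
  rw [← Finset.univ_sum_single a]
  exact sum_mem fun i _ => hsingle i (a i)

theorem swap_add_single_mem_borrowedPerm {n : ℕ} (y : Bits n) (t : Fin n) :
    Equiv.swap y (y + Pi.single t 1) ∈ borrowedPerm n := by
  -- The NOT on `t` controlled by all other qubits exchanges just the all-ones string and its
  -- neighbour in direction `t`. Conjugating by translation by `y - 1` carries this pair to the
  -- required one.
  have h1 : Equiv.swap (1 : Bits n) (1 + Pi.single t 1) ∈ borrowedPerm n := by
    rw [mem_borrowedPerm]
    convert ctrlNot_mem_borrowedMonoid (C := Finset.univ.erase t) (t := t) (by simp) using 2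
    funext x j
    have hx : x = 1 ∨ x = 1 + Pi.single t 1 ↔ ∀ c ∈ Finset.univ.erase t, x c = 1 := by
      constructor
      · rintro (rfl | rfl) c hc
        · rfl
        · simp [Finset.ne_of_mem_erase hc]
      · intro h
        rcases (by omega : x t = 1 ∨ x t = 1 + 1) with ht | ht
        · left
          funext c
          by_cases hc : c = t
          · rw [hc, ht]; rfl
          · exact h c (by simp [hc])
        · right
          funext c
          by_cases hc : c = t
          · rw [hc, ht]; simp
          · simp [hc, h c (by simp [hc])]
    by_cases h : ∀ c ∈ Finset.univ.erase t, x c = 1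
    · rw [ctrlNot, if_pos h]
      rcases hx.2 h with rfl | rfl
      · rw [Equiv.swap_apply_left]
        by_cases hj : j = t
        · subst hj; simp
        · simp [hj]
      · rw [Equiv.swap_apply_right]
        by_cases hj : j = t
        · subst hj; simp
        · simp [hj]
    · rw [ctrlNot, if_neg h]
      have := mt hx.1 h
      rw [not_or] at this
      rw [Equiv.swap_apply_of_ne_of_ne this.1 this.2]
  have h2 := addRight_mem_borrowedPerm (y - 1)
  have h3 := mul_mem (mul_mem h2 h1) (inv_mem h2)
  rw [← Equiv.swap_apply_apply] at h3
  convert h3 using 2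
  · simp
  · simp only [Equiv.coe_addRight]; abel

/-- Strings are joined by paths of single-bit changes, and transpositions compose along paths by
conjugation. -/
theorem swap_mem_borrowedPerm {n : ℕ} (y z : Bits n) : Equiv.swap y z ∈ borrowedPerm n := by
  have htrans : ∀ x y z : Bits n, Equiv.swap x y ∈ borrowedPerm n →
      Equiv.swap y z ∈ borrowedPerm n → Equiv.swap x z ∈ borrowedPerm n := by
    intro x y z hxy hyz
    exact SubmonoidClass.swap_mem_trans _ hxy hyz
  let S : AddSubmonoid (Bits n) :=
    { carrier := {a | ∀ y, Equiv.swap y (y + a) ∈ borrowedPerm n}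
      zero_mem' := fun y => by
        rw [add_zero, Equiv.swap_self]; exact one_mem _
      add_mem' := fun {a b} ha hb y => by
        rw [← add_assoc]
        exact htrans _ _ _ (ha y) (hb _) }
  have hsingle : ∀ i (x : Fin 2), Pi.single i x ∈ S := by
    intro i x
    rcases (by omega : x = 0 ∨ x = 1) with rfl | rfl
    · rw [Pi.single_zero]; exact zero_mem S
    · exact fun y => swap_add_single_mem_borrowedPerm y i
  have h : z - y ∈ S := by
    rw [← Finset.univ_sum_single (z - y)]
    exact sum_mem fun i _ => hsingle i _
  simpa using h y

theorem perm_mem_borrowedMonoid {n : ℕ} (σ : Equiv.Perm (Bits n)) :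
    funMat σ ∈ borrowedMonoid n := by
  rw [← mem_borrowedPerm]
  induction σ using Equiv.Perm.swap_induction_on with
  | one => exact one_mem _
  | swap_mul f x y _ ih => exact mul_mem (swap_mem_borrowedPerm x y) ih

/-! ### Operators on two basis states -/

section TwoLevel

variable {ι : Type*} [DecidableEq ι]

/-- The matrix `U` acting on the span of the basis vectors `i`, `j`, and the identity elsewhere. -/
def twoLevel (i j : ι) (U : Matrix (Fin 2) (Fin 2) ℂ) : Matrix ι ι ℂ := fun x y =>
  if x = i then if y = i then U 0 0 else if y = j then U 0 1 else 0
  else if x = j then if y = i then U 1 0 else if y = j then U 1 1 else 0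
  else if x = y then 1 else 0

/-- The diagonal matrix with entry `-1` at `i` and `1` elsewhere. -/
def negAt (i : ι) : Matrix ι ι ℂ := Matrix.diagonal fun x => if x = i then -1 else 1

variable [Fintype ι]

theorem funMat_mul_mul_apply (σ : Equiv.Perm ι) (M : Matrix ι ι ℂ) (x y : ι) :
    (funMat σ * M * funMat (σ⁻¹ : Equiv.Perm ι)) x y = M (σ⁻¹ x) (σ⁻¹ y) := by
  rw [Matrix.mul_apply, Finset.sum_eq_single (σ⁻¹ y)]
  · rw [funMat_mul_apply]; simp [funMat]
  · intro z _ hz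
    rw [funMat, if_neg hz, mul_zero]
  · simp

theorem funMat_conj_twoLevel (σ : Equiv.Perm ι) (i j : ι) (U : Matrix (Fin 2) (Fin 2) ℂ) :
    funMat σ * twoLevel i j U * funMat (σ⁻¹ : Equiv.Perm ι) = twoLevel (σ i) (σ j) U := by
  ext x y
  rw [funMat_mul_mul_apply]
  simp only [twoLevel, Equiv.Perm.inv_eq_iff_eq, EmbeddingLike.apply_eq_iff_eq]

theorem funMat_conj_negAt (σ : Equiv.Perm ι) (i : ι) :
    funMat σ * negAt i * funMat (σ⁻¹ : Equiv.Perm ι) = negAt (σ i) := by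
  ext x y
  rw [funMat_mul_mul_apply]
  simp only [negAt, Matrix.diagonal_apply, Equiv.Perm.inv_eq_iff_eq,
    EmbeddingLike.apply_eq_iff_eq]

theorem twoLevel_mul_apply_left (i j : ι) (hij : i ≠ j) (U : Matrix (Fin 2) (Fin 2) ℂ)
    (V : Matrix ι ι ℂ) (y : ι) :
    (twoLevel i j U * V) i y = U 0 0 * V i y + U 0 1 * V j y := by
  rw [Matrix.mul_apply, Finset.sum_eq_add_of_mem i j (by simp) (by simp) hij]
  · simp [twoLevel, hij.symm]
  · rintro c - ⟨h1, h2⟩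
    simp [twoLevel, h1, h2]

theorem twoLevel_mul_apply_right (i j : ι) (hij : i ≠ j) (U : Matrix (Fin 2) (Fin 2) ℂ)
    (V : Matrix ι ι ℂ) (y : ι) :
    (twoLevel i j U * V) j y = U 1 0 * V i y + U 1 1 * V j y := by
  rw [Matrix.mul_apply, Finset.sum_eq_add_of_mem i j (by simp) (by simp) hij]
  · simp [twoLevel, hij.symm]
  · rintro c - ⟨h1, h2⟩
    simp [twoLevel, h1, h2, hij.symm]

theorem twoLevel_mul_apply_of_ne {i j x : ι} (hi : x ≠ i) (hj : x ≠ j)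
    (U : Matrix (Fin 2) (Fin 2) ℂ) (V : Matrix ι ι ℂ) (y : ι) :
    (twoLevel i j U * V) x y = V x y := by
  simp [Matrix.mul_apply, twoLevel, hi, hj]

theorem negAt_mul_apply (i : ι) (V : Matrix ι ι ℂ) (x y : ι) :
    (negAt i * V) x y = (if x = i then -1 else 1) * V x y := by
  simp [negAt, Matrix.diagonal_mul]

omit [Fintype ι] in
theorem exists_perm_pair {a b i j : ι} (hab : a ≠ b) (hij : i ≠ j) :
    ∃ σ : Equiv.Perm ι, σ a = i ∧ σ b = j := by
  -- Once `a` has been moved to `i`, the image of `b` is not `i`, so the swap sending it to `j`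
  -- keeps `i` fixed.
  have h : Equiv.swap a i b ≠ i := by
    intro h
    rw [Equiv.swap_apply_eq_iff, Equiv.swap_apply_right] at h
    exact hab h.symm
  refine ⟨Equiv.swap (Equiv.swap a i b) j * Equiv.swap a i, ?_, ?_⟩
  · simp [Equiv.swap_apply_of_ne_of_ne h.symm hij]
  · simp

end TwoLevel

/-! ### Uniformly controlled operators on the first qubit -/

/-- The operator that applies `f y` to the first qubit if the others are in the state `y`. -/
def uniform {m : ℕ} (f : Bits m → Matrix (Fin 2) (Fin 2) ℂ) :
    Matrix (Bits (m + 1)) (Bits (m + 1)) ℂ :=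
  (Matrix.blockDiagonal f).submatrix (Fin.consEquiv fun _ => Fin 2).symm
    (Fin.consEquiv fun _ => Fin 2).symm

/-- `uniform` as a monoid homomorphism. -/
def uniformHom (m : ℕ) : (Bits m → Matrix (Fin 2) (Fin 2) ℂ) →*
    Matrix (Bits (m + 1)) (Bits (m + 1)) ℂ where
  toFun := uniform
  map_one' := by simp [uniform]
  map_mul' f g := by
    simp only [uniform, Matrix.submatrix_mul_equiv, ← Matrix.blockDiagonal_mul]
    rfl

theorem uniform_apply {m : ℕ} (f : Bits m → Matrix (Fin 2) (Fin 2) ℂ) (x y : Bits (m + 1)) :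
    uniform f x y = if Fin.tail x = Fin.tail y then f (Fin.tail x) (x 0) (y 0) else 0 := rfl

/-- The embedding of the first qubit. -/
def firstWire (m : ℕ) : Fin 1 ↪ Fin (m + 1) := ⟨fun _ => 0, fun _ _ _ => Subsingleton.elim _ _⟩

theorem uniform_const {m : ℕ} (U : Matrix (Fin 2) (Fin 2) ℂ) :
    uniform (fun _ : Bits m => U) = onWires (oneQubit U) (firstWire m) := by
  ext x y
  have h : (∀ j, (∀ i, firstWire m i ≠ j) → x j = y j) ↔ Fin.tail x = Fin.tail y := by
    rw [funext_iff, Fin.forall_fin_succ]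
    simp [show ∀ i, firstWire m i = 0 from fun _ => rfl, Fin.tail, (Fin.succ_ne_zero _).symm]
  simp only [uniform_apply, onWires, h]
  rfl

theorem uniform_mulSingle {m : ℕ} (y : Bits m) (U : Matrix (Fin 2) (Fin 2) ℂ) :
    uniform (Pi.mulSingle y U) = twoLevel (Fin.cons 0 y) (Fin.cons 1 y : Bits (m + 1)) U := by
  ext x z
  obtain ⟨a, x, rfl⟩ : ∃ a x', x = (Fin.cons a x' : Bits (m + 1)) :=
    ⟨_, _, (Fin.cons_self_tail x).symm⟩
  obtain ⟨b, z, rfl⟩ : ∃ a x', z = (Fin.cons a x' : Bits (m + 1)) :=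
    ⟨_, _, (Fin.cons_self_tail z).symm⟩
  simp only [uniform_apply, twoLevel, Fin.cons_inj, Fin.tail_cons, Fin.cons_zero]
  by_cases hx : x = y
  · subst hx
    by_cases hz : z = x
    · subst hz
      fin_cases a <;> fin_cases b <;> simp
    · simp only [Ne.symm hz, hz]
      fin_cases a <;> simp
  · rw [Pi.mulSingle_eq_of_ne hx]
    by_cases hxz : x = z
    · subst hxz; simp [hx, Matrix.one_apply]
    · simp [hx, hxz]

/-- The operators controlled by all the qubits but the first that a circuit realises. -/
noncomputable def uniformMonoid (m : ℕ) : Submonoid (Bits m → Matrix (Fin 2) (Fin 2) ℂ) :=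
  (borrowedMonoid (m + 1)).comap (uniformHom m)

theorem mem_uniformMonoid {m : ℕ} {f : Bits m → Matrix (Fin 2) (Fin 2) ℂ} :
    f ∈ uniformMonoid m ↔ uniform f ∈ borrowedMonoid (m + 1) := Iff.rfl

theorem const_matF_mem_uniformMonoid (m : ℕ) : (fun _ => matF) ∈ uniformMonoid m := by
  rw [mem_uniformMonoid, uniform_const, mem_borrowedMonoid, onWires_onWires]
  exact gate_mem_circuitMonoid .F _

theorem mulSingle_matX_mem_uniformMonoid {m : ℕ} (y : Bits m) :
    Pi.mulSingle y matX ∈ uniformMonoid m := by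
  rw [mem_uniformMonoid, uniform_mulSingle]
  convert perm_mem_borrowedMonoid (Equiv.swap (Fin.cons 0 y) (Fin.cons 1 y : Bits (m + 1)))
  have h01 : (Fin.cons 0 y : Bits (m + 1)) ≠ Fin.cons 1 y := by simp [Fin.cons_inj]
  ext x z
  simp only [twoLevel, funMat]
  by_cases h0 : z = Fin.cons 0 y
  · subst h0
    rw [Equiv.swap_apply_left]
    by_cases h0 : x = Fin.cons 0 y
    · simp [h0, h01, matX]
    · by_cases h1 : x = Fin.cons 1 y
      · simp [h1, h01.symm, matX]
      · simp [h0, h1]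
  by_cases h1 : z = Fin.cons 1 y
  · subst h1
    rw [Equiv.swap_apply_right]
    by_cases h0 : x = Fin.cons 0 y
    · simp [h0, h01.symm, matX]
    · by_cases h1 : x = Fin.cons 1 y
      · simp [h1, h01.symm, matX]
      · simp [h0, h1]
  rw [Equiv.swap_apply_of_ne_of_ne h0 h1]
  by_cases h2 : x = z
  · subst h2; simp [h0, h1]
  · simp [h0, h1, h2]

theorem mulSingle_matZ_mem_uniformMonoid {m : ℕ} (y : Bits m) :
    Pi.mulSingle y matZ ∈ uniformMonoid m := by
  have hF := const_matF_mem_uniformMonoid m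
  -- Products are computed pointwise: at `y` the word is `F² X F⁶ = Z`, elsewhere it is `F⁸ = 1`.
  convert mul_mem (mul_mem (pow_mem hF 2) (mulSingle_matX_mem_uniformMonoid y)) (pow_mem hF 6)
    using 1
  funext z
  by_cases hz : z = y
  · subst hz
    simp [matF_conj_matX]
  · simp [Pi.mulSingle_eq_of_ne hz, ← pow_add, matF_pow_eight]

theorem mulSingle_matF_mem_uniformMonoid {m : ℕ} (y : Bits m) :
    Pi.mulSingle y matF ∈ uniformMonoid m := by
  have hF := const_matF_mem_uniformMonoid m
  have hX := fun z : Bits m => mulSingle_matX_mem_uniformMonoid z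
  have hZ := fun z : Bits m => mulSingle_matZ_mem_uniformMonoid z
  have h : ∀ z : Bits m, Pi.mulSingle z (matX * matZ) ∈ uniformMonoid m := fun z => by
    rw [Pi.mulSingle_mul]; exact mul_mem (hX z) (hZ z)
  have h1 : (fun z => if z = y then matX else matX * matZ) ∈ uniformMonoid m :=
    Submonoid.pi_mem_of_mulSingle_mem _ fun z => by
      split_ifs
      exacts [hX z, h z]
  have h2 : (fun z => if z = y then matZ else matX * matZ) ∈ uniformMonoid m :=
    Submonoid.pi_mem_of_mulSingle_mem _ fun z => by
      split_ifs
      exacts [hZ z, h z]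
  -- At `y` this is `Z F X F Z = F`; at every other `z` it is `F (X Z) F (X Z) = 1`.
  convert mul_mem (mul_mem (mul_mem (mul_mem (hZ y) hF) h1) hF) h2 using 1
  funext z
  by_cases hz : z = y
  · subst hz
    simp [matF_eq_word]
  · simp [hz, matF_word_eq_one]

theorem twoLevel_matF_mem_borrowedMonoid {n : ℕ} {i j : Bits n} (hij : i ≠ j) :
    twoLevel i j matF ∈ borrowedMonoid n := by
  cases n with
  | zero => exact absurd (Subsingleton.elim i j) hij
  | succ m =>
    have h := mulSingle_matF_mem_uniformMonoid (0 : Bits m)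
    rw [mem_uniformMonoid, uniform_mulSingle] at h
    obtain ⟨σ, hi, hj⟩ := exists_perm_pair (a := (Fin.cons 0 0 : Bits (m + 1)))
      (b := Fin.cons 1 0) (by simp [Fin.cons_inj]) hij
    rw [← hi, ← hj, ← funMat_conj_twoLevel]
    exact mul_mem (mul_mem (perm_mem_borrowedMonoid _) h) (perm_mem_borrowedMonoid _)

theorem negAt_mem_borrowedMonoid {n : ℕ} (i : Bits n) : negAt i ∈ borrowedMonoid n := by
  cases n with
  | zero =>
    -- With no qubits, `negAt i` is the scalar `-1`, obtained as `F⁴` on the ancilla.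
    have h : uniformHom 0 (fun _ => matF) ∈ circuitMonoid 1 := by
      change uniform _ ∈ _
      rw [uniform_const]
      exact gate_mem_circuitMonoid .F _
    have h4 := pow_mem h 4
    rw [← map_pow, show (fun _ : Bits 0 => matF) ^ 4 = fun _ => -1 from
      funext fun _ => matF_pow_four] at h4
    rw [mem_borrowedMonoid]
    convert h4 using 1
    ext x y
    change _ = uniform _ x y
    rw [uniform_apply, if_pos (Subsingleton.elim _ _), Matrix.neg_apply, Matrix.one_apply]
    have hx : (∀ j, (∀ i : Fin 0, Fin.castAddEmb 1 i ≠ j) → x j = y j) ↔ x 0 = y 0 :=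
      ⟨fun h => h 0 fun i => i.elim0, fun h j _ => by rwa [Subsingleton.elim (α := Fin 1) j 0]⟩
    have hi : ∀ u v : Bits 0, negAt i u v = -1 := fun u v => by
      simp [negAt, Subsingleton.elim u i, Subsingleton.elim v i]
    simp only [onWires, hx, hi]
    split_ifs <;> simp
  | succ m =>
    have h := mulSingle_matZ_mem_uniformMonoid (0 : Bits m)
    rw [mem_uniformMonoid, uniform_mulSingle] at h
    have h2 : twoLevel (Fin.cons 0 0) (Fin.cons 1 0 : Bits (m + 1)) matZ =
        negAt (Fin.cons 1 0 : Bits (m + 1)) := by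
      ext x y
      by_cases h0 : x = Fin.cons 0 0
      · subst h0
        by_cases hy : y = Fin.cons 0 0
        · subst hy
          simp [twoLevel, negAt, matZ, Fin.cons_inj]
        · simp [twoLevel, negAt, matZ, hy, Ne.symm hy]
      · by_cases h1 : x = Fin.cons 1 0
        · subst h1
          by_cases hy : y = Fin.cons 1 0
          · subst hy
            simp [twoLevel, negAt, matZ, Fin.cons_inj]
          · simp [twoLevel, negAt, matZ, hy, Ne.symm hy, Fin.cons_inj]
        · by_cases hy : x = y
          · subst hy; simp [twoLevel, negAt, h0, h1]
          · simp [twoLevel, negAt, h0, h1, hy]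
    rw [h2] at h
    have := mul_mem (mul_mem (perm_mem_borrowedMonoid (Equiv.swap (Fin.cons 1 0) i)) h)
      (perm_mem_borrowedMonoid (Equiv.swap (Fin.cons 1 0) i)⁻¹)
    rwa [funMat_conj_negAt, Equiv.swap_apply_left] at this

/-! ### Exact synthesis by column reduction -/

theorem matF_zero_zero : matF 0 0 = (1 + iSqrtTwo) / 2 := by simp [matF]; ring
theorem matF_zero_one : matF 0 1 = 1 / 2 := by simp [matF]
theorem matF_one_zero : matF 1 0 = 1 / 2 := by simp [matF]
theorem matF_one_one : matF 1 1 = (-1 + iSqrtTwo) / 2 := by simp [matF]; ring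

section Synthesis

variable {ι : Type*} [Fintype ι] [DecidableEq ι]

/-- `E` maps two rows with numerators `a + b i√2` and `c + d i√2` to rows with numerators divisible
by `i√2`, and leaves the other rows alone. -/
structure Reduces (i j : ι) (a b c d : ℤ) (E : Matrix ι ι ℂ) : Prop where
  of_ne : ∀ (V : Matrix ι ι ℂ) x y, x ≠ i → x ≠ j → (E * V) x y = V x y
  of_zero : ∀ (V : Matrix ι ι ℂ) y, V i y = 0 → V j y = 0 → (E * V) i y = 0 ∧ (E * V) j y = 0
  even : ∀ (V : Matrix ι ι ℂ) y k, iSqrtTwo ^ k * V i y = a + b * iSqrtTwo →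
    iSqrtTwo ^ k * V j y = c + d * iSqrtTwo →
    (∃ p q : ℤ, Even p ∧ iSqrtTwo ^ k * (E * V) i y = p + q * iSqrtTwo) ∧
    ∃ p q : ℤ, Even p ∧ iSqrtTwo ^ k * (E * V) j y = p + q * iSqrtTwo

theorem reduces_matF_mul_matF {i j : ι} (hij : i ≠ j) {a b c d : ℤ} (hac : Even (a + c))
    (hbd : Even (b + d)) : Reduces i j a b c d (twoLevel i j matF * twoLevel i j matF) where
  of_ne V x y hi hj := by
    rw [mul_assoc, twoLevel_mul_apply_of_ne hi hj, twoLevel_mul_apply_of_ne hi hj]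
  of_zero V y hi hj := by
    simp only [mul_assoc, twoLevel_mul_apply_left i j hij, twoLevel_mul_apply_right i j hij, hi, hj]
    simp
  even V y k hi hj := by
    have h := iSqrtTwo_mul_self
    obtain ⟨p, hp⟩ := hac
    obtain ⟨q, hq⟩ := hbd
    have hp' : (a : ℂ) + c = p + p := by exact_mod_cast hp
    have hq' : (b : ℂ) + d = q + q := by exact_mod_cast hq
    simp only [mul_assoc, twoLevel_mul_apply_left i j hij, twoLevel_mul_apply_right i j hij,
      matF_zero_zero, matF_zero_one, matF_one_zero, matF_one_one]
    -- The new numerators are `s` times half the sum and half the difference of the old ones; both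
    -- halves lie in `ℤ[s]` by the parity hypotheses.
    refine ⟨⟨-2 * q, p, by simp, ?_⟩, ⟨-2 * (b - q), a - p, by simp, ?_⟩⟩
    · push_cast
      linear_combination iSqrtTwo / 2 * (hi + hj) + iSqrtTwo / 2 * hp' - hq' +
        (iSqrtTwo ^ k * V i y / 4 + (b + d) / 2) * h
    · push_cast
      linear_combination iSqrtTwo / 2 * (hi - hj) - iSqrtTwo / 2 * hp' + hq' +
        (iSqrtTwo ^ k * V j y / 4 + (b - d) / 2) * h

theorem reduces_matF {i j : ι} (hij : i ≠ j) {a b c d : ℤ} (hc : Odd c) (hbd : Odd (b + d))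
    (h4 : 4 ∣ a + c - 2 * b) : Reduces i j a b c d (twoLevel i j matF) where
  of_ne V x y hi hj := twoLevel_mul_apply_of_ne hi hj _ _ _
  of_zero V y hi hj := by
    simp only [twoLevel_mul_apply_left i j hij, twoLevel_mul_apply_right i j hij, hi, hj]
    simp
  even V y k hi hj := by
    have h := iSqrtTwo_mul_self
    obtain ⟨p, hp⟩ := h4
    -- Here `a` is odd, since `h4` makes `a + c` even.
    obtain ⟨q, hq⟩ : Even (a + b + d) := by grind
    obtain ⟨r, hr⟩ : Even (c + d - b) := by grind
    have hp' : (a : ℂ) + c - 2 * b = 4 * p := by exact_mod_cast hp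
    have hq' : (a : ℂ) + b + d = q + q := by exact_mod_cast hq
    have hr' : (c : ℂ) + d - b = r + r := by exact_mod_cast hr
    simp only [twoLevel_mul_apply_left i j hij, twoLevel_mul_apply_right i j hij,
      matF_zero_zero, matF_zero_one, matF_one_zero, matF_one_one]
    refine ⟨⟨2 * p, q, by simp, ?_⟩, ⟨2 * (p - r), c - r, by simp, ?_⟩⟩
    · push_cast
      linear_combination (1 + iSqrtTwo) / 2 * hi + 1 / 2 * hj + 1 / 2 * hp' +
        iSqrtTwo / 2 * hq' + b / 2 * h
    · push_cast
      linear_combination 1 / 2 * hi + (-1 + iSqrtTwo) / 2 * hj + 1 / 2 * hp' -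
        (1 + iSqrtTwo / 2) * hr' + d / 2 * h

theorem Reduces.mul_negAt {i j : ι} (hij : i ≠ j) {a b c d : ℤ} {E : Matrix ι ι ℂ}
    (h : Reduces i j a b (-c) (-d) E) : Reduces i j a b c d (E * negAt j) where
  of_ne V x y hi hj := by
    rw [mul_assoc, h.of_ne _ _ _ hi hj, negAt_mul_apply, if_neg hj, one_mul]
  of_zero V y hi hj := by
    rw [mul_assoc]
    exact h.of_zero _ _ (by simp [negAt_mul_apply, hi]) (by simp [negAt_mul_apply, hj])
  even V y k hi hj := by
    rw [mul_assoc]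
    refine h.even _ _ _ (by simpa [negAt_mul_apply, hij] using hi) ?_
    rw [negAt_mul_apply, if_pos rfl]
    push_cast
    linear_combination -hj

/-- `V` fixes the basis vectors in `S`. -/
def FixesOn (S : Finset ι) (V : Matrix ι ι ℂ) : Prop :=
  ∀ y ∈ S, ∀ x, V x y = if x = y then 1 else 0

/-- Column `x` is a basis vector, and column `y` is orthogonal to it. -/
theorem FixesOn.apply_eq_zero {S : Finset ι} {V : Matrix ι ι ℂ} (h : FixesOn S V)
    (hV : V ∈ Matrix.unitaryGroup ι ℂ) {x y : ι} (hx : x ∈ S) (hy : y ∉ S) : V x y = 0 := by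
  have := congrFun (congrFun (Matrix.mem_unitaryGroup_iff'.1 hV) x) y
  rw [Matrix.mul_apply, Finset.sum_eq_single x] at this
  · simpa [Matrix.star_apply, h x hx, Matrix.one_apply, ne_of_mem_of_not_mem hx hy] using this
  · intro z _ hz
    simp [Matrix.star_apply, h x hx, hz]
  · simp

theorem sum_normSq_column {V : Matrix ι ι ℂ} (hV : V ∈ Matrix.unitaryGroup ι ℂ) (y : ι) :
    ∑ x, Complex.normSq (V x y) = 1 := by
  have := congrFun (congrFun (Matrix.mem_unitaryGroup_iff'.1 hV) y) y
  rw [Matrix.mul_apply, Matrix.one_apply_eq] at this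
  simp only [Matrix.star_apply, RCLike.star_def, ← Complex.normSq_eq_conj_mul_self] at this
  exact_mod_cast this

theorem sum_numerators {V : Matrix ι ι ℂ} (hV : V ∈ Matrix.unitaryGroup ι ℂ) {y : ι} {k : ℕ}
    {a b : ι → ℤ} (h : ∀ x, iSqrtTwo ^ k * V x y = a x + b x * iSqrtTwo) :
    ∑ x, (a x ^ 2 + 2 * b x ^ 2) = 2 ^ k := by
  have h1 : ∀ x, ((a x : ℝ) ^ 2 + 2 * (b x : ℝ) ^ 2) = 2 ^ k * Complex.normSq (V x y) := by
    intro x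
    rw [← normSq_add_mul_iSqrtTwo, ← h x, map_mul, map_pow, normSq_iSqrtTwo]
  have h2 : ∑ x, ((a x : ℝ) ^ 2 + 2 * (b x : ℝ) ^ 2) = 2 ^ k := by
    simp only [h1, ← Finset.mul_sum, sum_normSq_column hV, mul_one]
  exact_mod_cast h2

theorem exists_eq_one_of_sum_eq_one {f : ι → ℤ} (hf : ∀ x, 0 ≤ f x) (h : ∑ x, f x = 1) :
    ∃ i, f i = 1 ∧ ∀ x, x ≠ i → f x = 0 := by
  obtain ⟨i, -, hi⟩ := Finset.exists_ne_zero_of_sum_ne_zero (h.trans_ne one_ne_zero)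
  have h1 := Finset.add_sum_erase Finset.univ f (Finset.mem_univ i)
  have h2 : 0 ≤ ∑ x ∈ Finset.univ.erase i, f x := Finset.sum_nonneg fun x _ => hf x
  have h3 := hf i
  refine ⟨i, by omega, fun x hx => ?_⟩
  have h4 := Finset.single_le_sum (f := f) (s := Finset.univ.erase i) (fun x _ => hf x)
    (Finset.mem_erase.2 ⟨hx, Finset.mem_univ x⟩)
  have := hf x
  omega

/-- With a single odd `a i` the sum would be odd, but it is a positive power of `2`. -/
theorem exists_ne_odd {a b : ι → ℤ} {k : ℕ} (h : ∑ x, (a x ^ 2 + 2 * b x ^ 2) = 2 ^ (k + 1))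
    {i : ι} (hi : Odd (a i)) : ∃ j, i ≠ j ∧ Odd (a j) := by
  by_contra! hne
  have h1 := Finset.add_sum_erase Finset.univ (fun x => a x ^ 2 + 2 * b x ^ 2) (Finset.mem_univ i)
  have h2 : Even (∑ x ∈ Finset.univ.erase i, (a x ^ 2 + 2 * b x ^ 2)) :=
    Finset.even_sum _ fun x hx => by
      have := Int.not_odd_iff_even.1 (hne x (Finset.ne_of_mem_erase hx).symm)
      exact (this.pow_of_ne_zero two_ne_zero).add (even_two_mul _)
  have h3 : Odd (a i ^ 2 + 2 * b i ^ 2) := hi.pow.add_even (even_two_mul _)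
  have h4 : Even ((2 : ℤ) ^ (k + 1)) := even_two.pow_of_ne_zero (by omega)
  rw [h] at h1
  exact Int.not_even_iff_odd.2 (h1 ▸ h3.add_even h2) h4

/-! ### The induction on columns and denominator exponents -/

variable {L : Submonoid (Matrix ι ι ℂ)} (hL : L ≤ dyadicUnitary ι)
  (hstar : ∀ V ∈ L, star V ∈ L) (hperm : ∀ σ : Equiv.Perm ι, funMat σ ∈ L)
  (hneg : ∀ i, negAt i ∈ L) (hF : ∀ i j, i ≠ j → twoLevel i j matF ∈ L)

include hneg hF in
theorem exists_reduces {i j : ι} (hij : i ≠ j) {a b c d : ℤ} (ha : Odd a) (hc : Odd c) :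
    ∃ E ∈ L, Reduces i j a b c d E := by
  rcases Int.even_or_odd (b + d) with h | h
  · exact ⟨_, mul_mem (hF i j hij) (hF i j hij), reduces_matF_mul_matF hij (ha.add_odd hc) h⟩
  · by_cases h4 : 4 ∣ a + c - 2 * b
    · exact ⟨_, hF i j hij, reduces_matF hij hc h h4⟩
    -- Negating row `j` changes `a + c - 2 b` by `2 c`, which is `2` modulo `4`; as `a + c` is even,
    -- the divisibility by `4` that failed now holds.
    · refine ⟨_, mul_mem (hF i j hij) (hneg j),
        (reduces_matF hij hc.neg (by grind) ?_).mul_negAt hij⟩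
      obtain ⟨a, rfl⟩ := ha
      obtain ⟨c, rfl⟩ := hc
      omega

include hL hstar in
theorem mem_of_mul_mem {E V : Matrix ι ι ℂ} (hE : E ∈ L) (h : E * V ∈ L) : V ∈ L := by
  have := mul_mem (hstar E hE) h
  rwa [← mul_assoc, Matrix.mem_unitaryGroup_iff'.1 (hL hE).1, one_mul] at this

include hL hstar hperm hneg in
theorem mem_of_integral_column {S : Finset ι} {j : ι} (hj : j ∉ S)
    (next : ∀ V ∈ dyadicUnitary ι, FixesOn (insert j S) V → V ∈ L)
    {V : Matrix ι ι ℂ} (hV : V ∈ dyadicUnitary ι) (hS : FixesOn S V) {a b : ι → ℤ}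
    (h : ∀ x, iSqrtTwo ^ 0 * V x j = a x + b x * iSqrtTwo) : V ∈ L := by
  -- For `k = 0` the norms are nonnegative integers of sum `1`, so the column has a single nonzero
  -- entry, which is `1` or `-1`.
  obtain ⟨i, hi, hne⟩ := exists_eq_one_of_sum_eq_one (fun x => by positivity)
    ((sum_numerators hV.1 h).trans (pow_zero 2))
  have h0 : ∀ x, x ≠ i → V x j = 0 := by
    intro x hx
    have h1 := hne x hx
    have h2 : a x = 0 := by nlinarith [sq_nonneg (a x), sq_nonneg (b x)]
    have h3 : b x = 0 := by nlinarith [sq_nonneg (a x), sq_nonneg (b x)]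
    simpa [h2, h3] using h x
  have hb : b i = 0 := by
    by_contra hb
    have := Int.one_le_abs hb
    nlinarith [sq_abs (b i), sq_nonneg (a i)]
  have hi1 : V i j = a i := by simpa [hb] using h i
  have hiS : i ∉ S := by
    intro hiS
    have := hS.apply_eq_zero hV.1 hiS hj
    rw [hi1, Int.cast_eq_zero] at this
    simp [this, hb] at hi
  have swap : ∀ W ∈ dyadicUnitary ι, FixesOn S W → (∀ x, x ≠ i → W x j = 0) → W i j = 1 →
      W ∈ L := by
    intro W hW hWS hW0 hW1
    refine mem_of_mul_mem hL hstar (hperm (Equiv.swap i j))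
      (next _ (mul_mem (hL (hperm _)) hW) fun y hy x => ?_)
    rw [funMat_mul_apply, Equiv.swap_inv]
    rcases Finset.mem_insert.1 hy with rfl | hy
    · by_cases hx : x = y
      · subst hx; simpa using hW1
      · rw [if_neg hx]
        refine hW0 _ fun e => hx ?_
        rwa [Equiv.swap_apply_eq_iff, Equiv.swap_apply_left] at e
    · rw [hWS y hy]
      have hyi : y ≠ i := ne_of_mem_of_not_mem hy hiS
      have hyj : y ≠ j := ne_of_mem_of_not_mem hy hj
      simp only [Equiv.swap_apply_eq_iff, Equiv.swap_apply_of_ne_of_ne hyi hyj]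
  have ha : a i = 1 ∨ a i = -1 := by
    rw [hb] at hi
    exact mul_self_eq_one_iff.1 (by simpa [sq] using hi)
  rcases ha with ha | ha
  · exact swap V hV hS h0 (by rw [hi1, ha]; simp)
  · refine mem_of_mul_mem hL hstar (hneg i) (swap _ (mul_mem (hL (hneg i)) hV) ?_ ?_ ?_)
    · intro y hy x
      rw [negAt_mul_apply, hS y hy]
      by_cases hx : x = i
      · subst hx; simp [(ne_of_mem_of_not_mem hy hiS).symm]
      · simp [hx]
    · intro x hx
      rw [negAt_mul_apply, h0 x hx, mul_zero]
    · rw [negAt_mul_apply, hi1, ha]; simp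

include hL hstar hperm hneg hF in
theorem mem_of_numerators {S : Finset ι} {j : ι} (hj : j ∉ S)
    (next : ∀ V ∈ dyadicUnitary ι, FixesOn (insert j S) V → V ∈ L) (k : ℕ) :
    ∀ V ∈ dyadicUnitary ι, FixesOn S V →
      (∀ x, ∃ a b : ℤ, iSqrtTwo ^ k * V x j = a + b * iSqrtTwo) → V ∈ L := by
  induction k with
  | zero =>
    intro V hV hS h
    choose a b h using h
    exact mem_of_integral_column hL hstar hperm hneg hj next hV hS h
  | succ k ih =>
    -- Inner induction on a bound `N` for the number of rows whose numerator is not divisible by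
    -- `i√2`.
    have key : ∀ (N : ℕ) (V : Matrix ι ι ℂ) (a b : ι → ℤ), V ∈ dyadicUnitary ι → FixesOn S V →
        (∀ x, iSqrtTwo ^ (k + 1) * V x j = a x + b x * iSqrtTwo) →
        (Finset.univ.filter fun x => Odd (a x)).card ≤ N → V ∈ L := by
      intro N
      induction N with
      | zero =>
        intro V a b hV hS h hN
        refine ih V hV hS fun x => ?_
        have hx : Even (a x) := by
          rw [← Int.not_odd_iff_even]
          intro hx
          have := Finset.card_eq_zero.1 (Nat.le_zero.1 hN)
          have hmem : x ∈ Finset.univ.filter fun x => Odd (a x) := by simpa using hx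
          simp [this] at hmem
        obtain ⟨p, hp⟩ := hx
        have hp' : (a x : ℂ) = p + p := by exact_mod_cast hp
        -- With `a x = 2 p`, the quotient of `2 p + b s` by `s` is `b - p s`.
        refine ⟨b x, -p, mul_left_cancel₀ iSqrtTwo_ne_zero ?_⟩
        push_cast
        linear_combination h x + hp' + p * iSqrtTwo_mul_self
      | succ N ihN =>
        intro V a b hV hS h hN
        by_cases hodd : ∃ i, Odd (a i)
        · obtain ⟨i, hi⟩ := hodd
          obtain ⟨l, hil, hl⟩ := exists_ne_odd (sum_numerators hV.1 h) hi
          -- Rows in `S` have entry zero in column `j`, so the reduction acts on rows outside `S`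
          -- and preserves the columns already fixed.
          have hrow : ∀ x, Odd (a x) → x ∉ S := by
            intro x hx hxS
            have h1 := h x
            rw [hS.apply_eq_zero hV.1 hxS hj, mul_zero] at h1
            have h2 := congrArg Complex.normSq h1
            rw [normSq_add_mul_iSqrtTwo, map_zero] at h2
            have h3 : a x ^ 2 + 2 * b x ^ 2 = 0 := by exact_mod_cast h2.symm
            have h4 : a x = 0 := by nlinarith [sq_nonneg (a x), sq_nonneg (b x)]
            simp [h4] at hx
          obtain ⟨E, hE, hred⟩ := exists_reduces hneg hF hil (b := b i) (d := b l) hi hl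
          obtain ⟨⟨p, q, hp, hpq⟩, ⟨r, s, hr, hrs⟩⟩ := hred.even V j (k + 1) (h i) (h l)
          refine mem_of_mul_mem hL hstar hE (ihN _
            (fun x => if x = i then p else if x = l then r else a x)
            (fun x => if x = i then q else if x = l then s else b x) (mul_mem (hL hE) hV) ?_ ?_ ?_)
          · intro y hy x
            have hyi : i ≠ y := (ne_of_mem_of_not_mem hy (hrow i hi)).symm
            have hyl : l ≠ y := (ne_of_mem_of_not_mem hy (hrow l hl)).symm
            have hz := hred.of_zero V y (by rw [hS y hy, if_neg hyi]) (by rw [hS y hy, if_neg hyl])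
            by_cases hxi : x = i
            · rw [hxi, hz.1, if_neg hyi]
            by_cases hxl : x = l
            · rw [hxl, hz.2, if_neg hyl]
            rw [hred.of_ne V x y hxi hxl, hS y hy]
          · intro x
            by_cases hxi : x = i
            · subst hxi; simpa using hpq
            by_cases hxl : x = l
            · subst hxl; simpa [hxi] using hrs
            simpa [hxi, hxl, hred.of_ne V x j hxi hxl] using h x
          · refine Nat.le_of_lt_succ (lt_of_lt_of_le (Finset.card_lt_card ?_) hN)
            refine Finset.ssubset_iff_of_subset (fun x hx => ?_) |>.2 ⟨i, by simpa using hi, ?_⟩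
            · simp only [Finset.mem_filter, Finset.mem_univ, true_and] at hx ⊢
              split_ifs at hx with h1 h2
              · exact absurd hp (Int.not_even_iff_odd.2 hx)
              · exact absurd hr (Int.not_even_iff_odd.2 hx)
              · exact hx
            · simpa using hp
        · refine ihN V a b hV hS h ?_
          simp [Finset.filter_false_of_mem fun x _ hx => hodd ⟨x, hx⟩]
    intro V hV hS h
    choose a b h using h
    exact key _ V a b hV hS h le_rfl

include hL hstar hperm hneg hF in
/-- A monoid of unitaries closed under adjoints that contains the permutation matrices, the
one-level operators `-1` and the two-level operators `F` contains all unitaries over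
`ℤ[1 / i√2]`. -/
theorem dyadicUnitary_le : dyadicUnitary ι ≤ L := by
  have key : ∀ T : Finset ι, ∀ V ∈ dyadicUnitary ι, FixesOn Tᶜ V → V ∈ L := by
    intro T
    induction T using Finset.induction_on with
    | empty =>
      intro V _ hS
      have : V = 1 := by
        ext x y
        rw [hS y (by simp), Matrix.one_apply]
      exact this ▸ one_mem L
    | insert j T hj ih =>
      intro V hV hS
      have hins : insert j (insert j T)ᶜ = Tᶜ := by
        ext x
        by_cases hx : x = j
        · subst hx; simp [hj]
        · simp [hx]
      choose k a b h using fun x => exists_numerator (hV.2 x j)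
      -- The sum of the exponents serves as a common denominator exponent for the column.
      refine mem_of_numerators hL hstar hperm hneg hF (by simp) (hins ▸ ih) (∑ x, k x) V hV hS
        fun x => numerator_mono (Finset.single_le_sum (f := k) (fun _ _ => Nat.zero_le _)
          (Finset.mem_univ x)) ⟨_, _, h x⟩
  exact fun V hV => key Finset.univ V hV fun y hy => by simp at hy

end Synthesis

end QCircuit

theorem mainTheorem3 (n : ℕ) (V : Matrix (QCircuit.Bits n) (QCircuit.Bits n) ℂ) :
    (QCircuit.ExactlyRepresentable V ↔
      V ∈ QCircuit.unitariesOver n QCircuit.dyadicISqrtTwo) ∧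
    (QCircuit.ExactlyRepresentable V → QCircuit.RepresentableWithAncillas 1 V) := by
  have h1 : QCircuit.ExactlyRepresentable V → V ∈ QCircuit.dyadicUnitary (QCircuit.Bits n) :=
    fun ⟨_, h⟩ => h.mem_dyadicUnitary
  have h2 : V ∈ QCircuit.dyadicUnitary (QCircuit.Bits n) →
      QCircuit.RepresentableWithAncillas 1 V := fun h =>
    QCircuit.representable_of_mem_borrowedMonoid
      (QCircuit.dyadicUnitary_le (QCircuit.borrowedMonoid_le_dyadicUnitary n)
        (fun _ => QCircuit.star_mem_borrowedMonoid) QCircuit.perm_mem_borrowedMonoid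
        QCircuit.negAt_mem_borrowedMonoid
        (fun _ _ => QCircuit.twoLevel_matF_mem_borrowedMonoid) h)
  exact ⟨⟨h1, fun h => ⟨1, h2 h⟩⟩, fun h => h2 (h1 h)⟩
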